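/- A \emph{Dedekind complete real $\Phi$-algebra} is a Dedekind complete real vector lattice $E$ (every non-empty subset that is bounded above has a supremum) with an associative bilinear multiplication with a unit $e$, such that $xy\ge 0$ whenever $x,y\ge 0$, and such that $x\wedge y=0$ and $z\ge 0$ imply $(zx)\wedge y=(xz)\wedge y=0$. An element $r\ge 0$ of $E$ is a \emph{weak order unit} if $|x|\wedge r=0$ implies $x=0$; we write $x\ll y$ if $y-x$ is a weak order unit, and we put $[a,b]=\{x\in E: a\le x\le b\}$, $(a,b)=\{x\in E: a\ll x\ll b\}$ and $N(c,r)=\{z\in E: |z-c|\ll r\}$. For $A\subseteq E$ we write $A\searrow 0$ if $\inf A=0$, and $A\downarrow 0$ if moreover $A$ is downwards directed. A net $(x_\alpha)$ \emph{converges in order} to $x$ if there is a set $\mathcal E\searrow 0$ such that for every $\varepsilon\in\mathcal E$ there is an $\alpha_0$ with $|x_\alpha-x|\le\varepsilon$ for all $\alpha\ge\alpha_0$. A function $f\colon D\to E$ with $D\subseteq E$ is \emph{order continuous} if for every $c\in D$ and every net $(x_\alpha)$ in $D$ that converges in order to $c$, the net $(f(x_\alpha))$ converges in order to $f(c)$.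 It is \emph{super order differentiable} at $c\in D$ with derivative $f'(c)$ if $N(c,r)\subseteq D$ for some weak order unit $r$, and for every $\Delta\downarrow 0$ there is a set $\mathcal E\searrow 0$ such that for every $\varepsilon\in\mathcal E$ there is a $\delta\in\Delta$ with \[ z\in D \text{ and } |z-c|\le\delta \implies |f(z)-f(c)-(z-c)f'(c)|\le |z-c|\,\varepsilon . \] \textbf{Mean Value Theorem.} Let $E$ be a Dedekind complete real $\Phi$-algebra and let $a,b\in E$ with $a\ll b$. Let $f\colon[a,b]\to E$ be order continuous on $[a,b]$ and super order differentiable at every point of $(a,b)$. Then there exists $x_0\in(a,b)$ such that \[ (b-a)f'(x_0)=f(b)-f(a). \] -/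

import Mathlib

/-- The axioms that make an associative algebra which is also a vector lattice an `f`-algebra:
products of positive elements are positive, and multiplying one of two disjoint positive elements
by a positive element, on either side, keeps them disjoint. Commutativity is not assumed. -/
class IsFAlgebra (E : Type*) [Ring E] [Lattice E] : Prop where
  mul_nonneg' : ∀ x y : E, 0 ≤ x → 0 ≤ y → 0 ≤ x * y
  left_disjoint : ∀ x y z : E, x ⊓ y = 0 → 0 ≤ z → (z * x) ⊓ y = 0
  right_disjoint : ∀ x y z : E, x ⊓ y = 0 → 0 ≤ z → (x * z) ⊓ y = 0

universe u

namespace OrderCalculus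

section Lattice

variable {E : Type*} [Ring E] [Lattice E]

/-- `r` is a weak order unit: it is positive, and only `0` is disjoint from it. -/
def IsWeakOrderUnit (r : E) : Prop :=
  0 ≤ r ∧ ∀ x : E, |x| ⊓ r = 0 → x = 0

/-- `x ≪ y`: the difference `y - x` is a weak order unit. -/
def WLt (x y : E) : Prop := IsWeakOrderUnit (y - x)

/-- The open order neighbourhood `N(c, r) = {z | |z - c| ≪ r}`. -/
def nhd (c r : E) : Set E := {z | WLt |z - c| r}

/-- The open order interval `(a, b) = {x | a ≪ x ≪ b}`. -/
def openInterval (a b : E) : Set E := {x | WLt a x ∧ WLt x b}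

/-- `A ↘ 0`: the infimum of `A` is `0`. -/
def InfZero (A : Set E) : Prop := IsGLB A 0

/-- `A ↓ 0`: the infimum of `A` is `0` and `A` is downwards directed. -/
def DownZero (A : Set E) : Prop := IsGLB A 0 ∧ DirectedOn (fun x y => y ≤ x) A

/-- Order convergence of a net `x` to `l`. -/
def OrderConverges {ι : Type*} [Preorder ι] (x : ι → E) (l : E) : Prop :=
  ∃ Eps : Set E, InfZero Eps ∧ ∀ ε ∈ Eps, ∃ i₀ : ι, ∀ i, i₀ ≤ i → |x i - l| ≤ ε

/-- Super order differentiability at `c`, with derivative `d`, of the restriction of `f` to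
the domain `D`. Values of `f` outside `D` play no role. -/
def HasSuperOrderDerivAt (f : E → E) (D : Set E) (c d : E) : Prop :=
  (∃ r : E, IsWeakOrderUnit r ∧ nhd c r ⊆ D) ∧
  ∀ Δ : Set E, DownZero Δ → ∃ Eps : Set E, InfZero Eps ∧ ∀ ε ∈ Eps, ∃ δ ∈ Δ,
    ∀ z ∈ D, |z - c| ≤ δ → |f z - f c - (z - c) * d| ≤ |z - c| * ε

end Lattice

/-- Order continuity at `c` of the restriction of `f` to the domain `D`: every net in `D` that
converges in order to `c` is mapped to a net that converges in order to `f c`. -/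
def OrderContinuousAt {E : Type u} [Ring E] [Lattice E] (f : E → E) (D : Set E) (c : E) : Prop :=
  ∀ (ι : Type u) [Preorder ι] [Nonempty ι] [IsDirectedOrder ι] (x : ι → E),
    (∀ i, x i ∈ D) → OrderConverges x c → OrderConverges (fun i => f (x i)) (f c)

/-- Order continuity on `D` of the restriction of `f` to the domain `D`. -/
def OrderContinuous {E : Type u} [Ring E] [Lattice E] (f : E → E) (D : Set E) : Prop :=
  ∀ c ∈ D, OrderContinuousAt f D c

end OrderCalculus

set_option linter.unusedSectionVars false

namespace OrderCalculus

/-! ### Arithmetic of f-algebras and components of the unit. -/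

section FAlgebra

variable {E : Type*} [Ring E] [Lattice E] [IsOrderedAddMonoid E] [IsFAlgebra E]

/-! The order is not total, so case distinctions on signs are replaced by components `p` of the
unit: central idempotents along which two elements `x`, `y` are glued to `p * x + (1 - p) * y`.
Every element is nonnegative on some component and nonpositive on its complement (`exists_sign`).
Differentiability makes `f` local: multiplying the derivative estimate by `p` shows that `p * f z`
depends only on `p * z` near a point, and connectedness and continuity extend this to `[a, b]`
(`localOn_of_hasSuperOrderDerivAt`). Local functions commute with gluing, so bisection proves an
intermediate value theorem (`exists_eq_zero`).

The mean value theorem then needs no extrema. With `h = (b - a) / 3` and `F = (f b - f a) / 3`, the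
function `f (x + h) - f x - F` has values at `a`, `a + h`, `a + 2h` with sum zero, hence a zero well
inside that interval (`exists_interior_eq_zero`). Repeated halving (`exists_increment_half`) gives
nested intervals of length `2⁻ⁿ h` on which `f` grows by `2⁻ⁿ F`. Their common point lies in `(a,
b)`, and the derivative estimate at both ends of each interval forces `F = h * f' x`. -/

theorem fmul_nonneg {x y : E} (hx : 0 ≤ x) (hy : 0 ≤ y) : 0 ≤ x * y :=
  IsFAlgebra.mul_nonneg' x y hx hy

theorem fmul_le_left {x y z : E} (hz : 0 ≤ z) (h : x ≤ y) : z * x ≤ z * y := by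
  have := fmul_nonneg hz (sub_nonneg.2 h)
  rwa [mul_sub, sub_nonneg] at this

theorem fmul_le_right {x y z : E} (hz : 0 ≤ z) (h : x ≤ y) : x * z ≤ y * z := by
  have := fmul_nonneg (sub_nonneg.2 h) hz
  rwa [sub_mul, sub_nonneg] at this

/-- Multiplying each factor in turn by the other keeps disjointness, so `x * y` is disjoint from
itself. -/
theorem mul_eq_zero_of_inf_eq_zero {x y : E} (h : x ⊓ y = 0) : x * y = 0 := by
  have hx : 0 ≤ x := h ▸ inf_le_left
  have hy : 0 ≤ y := h ▸ inf_le_right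
  have h1 := IsFAlgebra.right_disjoint x y y h hy
  rw [inf_comm] at h1
  simpa using IsFAlgebra.left_disjoint y (x * y) x h1 hx

theorem posPart_mul_negPart (x : E) : x⁺ * x⁻ = 0 :=
  mul_eq_zero_of_inf_eq_zero (posPart_inf_negPart_eq_zero x)

theorem negPart_mul_posPart (x : E) : x⁻ * x⁺ = 0 :=
  mul_eq_zero_of_inf_eq_zero (by rw [inf_comm, posPart_inf_negPart_eq_zero])

theorem fmul_self_nonneg (x : E) : 0 ≤ x * x := by
  have h : x * x = x⁺ * x⁺ + x⁻ * x⁻ := by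
    conv_lhs => rw [← posPart_sub_negPart x]
    rw [sub_mul, mul_sub, mul_sub, posPart_mul_negPart, negPart_mul_posPart]
    abel
  rw [h]
  exact add_nonneg (fmul_nonneg (posPart_nonneg x) (posPart_nonneg x))
    (fmul_nonneg (negPart_nonneg x) (negPart_nonneg x))

theorem one_nonneg' : (0 : E) ≤ 1 := by simpa using fmul_self_nonneg (1 : E)

theorem eq_zero_of_abs_nonpos {x : E} (h : |x| ≤ 0) : x = 0 :=
  le_antisymm ((le_abs_self x).trans h) (neg_nonpos.1 ((neg_le_abs x).trans h))

theorem abs_sub_of_inf_eq_zero {x y : E} (h : x ⊓ y = 0) : |x - y| = x + y := by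
  rw [abs_sub_comm, ← sup_sub_inf_eq_abs_sub, h, sub_zero,
    ← inf_add_sup x y, h, zero_add]

theorem abs_mul_of_nonneg {z : E} (hz : 0 ≤ z) (x : E) : |z * x| = z * |x| := by
  have h : (z * x⁺) ⊓ (z * x⁻) = 0 := by
    have h1 := IsFAlgebra.left_disjoint _ _ z (posPart_inf_negPart_eq_zero x) hz
    rw [inf_comm] at h1 ⊢
    exact IsFAlgebra.left_disjoint _ _ z h1 hz
  conv_lhs => rw [← posPart_sub_negPart x, mul_sub]
  rw [abs_sub_of_inf_eq_zero h, ← mul_add, posPart_add_negPart]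

/-- `p` is a component of the unit: `p` and `1 - p` are disjoint. -/
def IsComponent (p : E) : Prop := p ⊓ (1 - p) = 0

namespace IsComponent

variable {p q : E}

theorem compl (hp : IsComponent p) : IsComponent (1 - p) := by
  unfold IsComponent at *
  rwa [sub_sub_cancel, inf_comm]

theorem nonneg (hp : IsComponent p) : 0 ≤ p := hp ▸ inf_le_left

theorem compl_nonneg (hp : IsComponent p) : 0 ≤ 1 - p := hp ▸ inf_le_right

theorem mul_mul_compl (hp : IsComponent p) (x : E) : p * x * (1 - p) = 0 := by
  have key : ∀ y : E, 0 ≤ y → p * y * (1 - p) = 0 := fun y hy =>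
    mul_eq_zero_of_inf_eq_zero (IsFAlgebra.right_disjoint p (1 - p) y hp hy)
  rw [← posPart_sub_negPart x, mul_sub p, sub_mul, key _ (posPart_nonneg x),
    key _ (negPart_nonneg x), sub_zero]

/-- Both `p * x * (1 - p)` and `(1 - p) * x * p` vanish, so `p * x` and `x * p` both equal `p * x *
p`. This centrality replaces commutativity of `E`. -/
theorem comm (hp : IsComponent p) (x : E) : p * x = x * p := by
  have h1 := hp.mul_mul_compl x
  have h2 := hp.compl.mul_mul_compl x
  rw [sub_sub_cancel, sub_mul, one_mul, sub_mul, sub_eq_zero] at h2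
  rw [mul_sub, mul_one, sub_eq_zero] at h1
  rw [h1, h2]

theorem mul_self (hp : IsComponent p) : p * p = p := by
  have h1 := hp.mul_mul_compl 1
  rw [mul_one, mul_sub, mul_one, sub_eq_zero] at h1
  exact h1.symm

theorem mul_mul_self (hp : IsComponent p) (x : E) : p * (p * x) = p * x := by
  rw [← mul_assoc, hp.mul_self]

theorem mul_compl_mul (hp : IsComponent p) (x : E) : p * ((1 - p) * x) = 0 := by
  rw [sub_mul, one_mul, mul_sub, hp.mul_mul_self, sub_self]

theorem compl_mul_mul (hp : IsComponent p) (x : E) : (1 - p) * (p * x) = 0 := by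
  rw [sub_mul, one_mul, hp.mul_mul_self, sub_self]

theorem left_comm (hp : IsComponent p) (x y : E) : x * (p * y) = p * (x * y) := by
  rw [← mul_assoc, ← hp.comm x, mul_assoc]

theorem ext_of (_ : IsComponent p) {x y : E} (h1 : p * x = p * y)
    (h2 : (1 - p) * x = (1 - p) * y) : x = y := by
  have := congrArg₂ (· + ·) h1 h2
  simpa [← add_mul] using this

theorem le_of (_ : IsComponent p) {x y : E} (h1 : p * x ≤ p * y)
    (h2 : (1 - p) * x ≤ (1 - p) * y) : x ≤ y := by
  have := add_le_add h1 h2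
  simpa [← add_mul] using this

theorem mul_mix (hp : IsComponent p) (x y : E) : p * (p * x + (1 - p) * y) = p * x := by
  rw [mul_add, hp.mul_mul_self, hp.mul_compl_mul, add_zero]

theorem compl_mul_mix (hp : IsComponent p) (x y : E) :
    (1 - p) * (p * x + (1 - p) * y) = (1 - p) * y := by
  rw [mul_add, hp.compl.mul_mul_self, hp.compl_mul_mul, zero_add]

theorem mix_mem_Icc (hp : IsComponent p) {x y l u : E} (hx : x ∈ Set.Icc l u)
    (hy : y ∈ Set.Icc l u) : p * x + (1 - p) * y ∈ Set.Icc l u := by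
  constructor
  · apply hp.le_of
    · rw [hp.mul_mix]; exact fmul_le_left hp.nonneg hx.1
    · rw [hp.compl_mul_mix]; exact fmul_le_left hp.compl_nonneg hy.1
  · apply hp.le_of
    · rw [hp.mul_mix]; exact fmul_le_left hp.nonneg hx.2
    · rw [hp.compl_mul_mix]; exact fmul_le_left hp.compl_nonneg hy.2

/-- Multiplication by the reflection `p - (1 - p)` is an involution. -/
theorem refl_mul_refl_mul (hp : IsComponent p) (x : E) :
    (p - (1 - p)) * ((p - (1 - p)) * x) = x := by
  have h : ∀ y : E, (p - (1 - p)) * y = p * y - (1 - p) * y := sub_mul _ _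
  rw [h, h, mul_sub, mul_sub, hp.mul_mul_self, hp.mul_compl_mul, hp.compl_mul_mul,
    hp.compl.mul_mul_self, sub_mul]
  simp

end IsComponent

/-- `f` respects components on `D`. -/
def LocalOn (f : E → E) (D : Set E) : Prop :=
  ∀ p, IsComponent p → ∀ x ∈ D, ∀ y ∈ D, p * x = p * y → p * f x = p * f y

theorem LocalOn.map_mix {f : E → E} {l u : E} (hf : LocalOn f (Set.Icc l u)) {p x y : E}
    (hp : IsComponent p) (hx : x ∈ Set.Icc l u) (hy : y ∈ Set.Icc l u) :
    f (p * x + (1 - p) * y) = p * f x + (1 - p) * f y := by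
  have hm := hp.mix_mem_Icc hx hy
  apply hp.ext_of
  · rw [hp.mul_mix]
    exact hf p hp _ hm _ hx (hp.mul_mix x y)
  · rw [hp.compl_mul_mix]
    exact hf _ hp.compl _ hm _ hy (hp.compl_mul_mix x y)

end FAlgebra

/-! ### Archimedean estimates, supports and signs. -/

section Dedekind

variable {E : Type*} [Ring E] [ConditionallyCompleteLattice E] [IsOrderedAddMonoid E]
  [Algebra ℝ E] [IsOrderedModule ℝ E]

theorem pow_half_smul_succ (n : ℕ) (w : E) :
    (2 : ℝ) • ((1 / 2 : ℝ) ^ (n + 1) • w) = (1 / 2 : ℝ) ^ n • w := by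
  rw [smul_smul]
  congr 1
  rw [pow_succ]
  ring

theorem pow_half_smul_nonneg (n : ℕ) {w : E} (hw : 0 ≤ w) : 0 ≤ (1 / 2 : ℝ) ^ n • w :=
  smul_nonneg (by positivity) hw

theorem pow_half_smul_anti {m n : ℕ} (h : m ≤ n) {w : E} (hw : 0 ≤ w) :
    (1 / 2 : ℝ) ^ n • w ≤ (1 / 2 : ℝ) ^ m • w :=
  smul_le_smul_of_nonneg_right (pow_le_pow_of_le_one (by norm_num) (by norm_num) h) hw

/-- The Archimedean property. -/
theorem nonpos_of_forall_le_pow_smul {x w : E} (h : ∀ n : ℕ, x ≤ (1 / 2 : ℝ) ^ n • w) :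
    x ≤ 0 := by
  set S : Set E := Set.range fun n : ℕ => (1 / 2 : ℝ) ^ n • w
  have hlb : x ∈ lowerBounds S := by rintro _ ⟨n, rfl⟩; exact h n
  have hglb : IsGLB S (sInf S) := isGLB_csInf (Set.range_nonempty _) ⟨x, hlb⟩
  -- Doubling shifts the index by one, so the infimum dominates its own double.
  have h2 : (2 : ℝ) • sInf S ≤ sInf S := by
    apply hglb.2
    rintro _ ⟨n, rfl⟩
    have := smul_le_smul_of_nonneg_left (hglb.1 ⟨n + 1, rfl⟩) (zero_le_two (α := ℝ))
    rwa [pow_half_smul_succ] at this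
  rw [two_smul] at h2
  exact (hglb.2 hlb).trans (by simpa using h2)

theorem downZero_pow_smul {w : E} (hw : 0 ≤ w) :
    DownZero (Set.range fun n : ℕ => (1 / 2 : ℝ) ^ n • w) := by
  refine ⟨⟨?_, fun x hx => nonpos_of_forall_le_pow_smul fun n => hx ⟨n, rfl⟩⟩, ?_⟩
  · rintro _ ⟨n, rfl⟩
    exact pow_half_smul_nonneg n hw
  · rintro _ ⟨m, rfl⟩ _ ⟨n, rfl⟩
    exact ⟨_, ⟨max m n, rfl⟩, pow_half_smul_anti (le_max_left _ _) hw,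
      pow_half_smul_anti (le_max_right _ _) hw⟩

variable [IsFAlgebra E]

/-- The factor `w` need not be bounded by a multiple of `1`, so it is truncated: `u = (c • 1 - w)⁺`
satisfies `u * w ≤ c • u`, whence `u * z⁺ ≤ c² • ε` for all `ε`, and so `u * z⁺ ≤ 0`. Then `c • z⁺ ≤
w * z⁺` for every `c = 2 ^ m`, and the Archimedean property applies. -/
theorem nonpos_of_forall_le_mul {z w : E} (hw : 0 ≤ w) {Eps : Set E} (hEps : InfZero Eps)
    (h : ∀ ε ∈ Eps, z ≤ w * ε) : z ≤ 0 := by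
  set y := z⁺ with hy
  have hy0 : 0 ≤ y := posPart_nonneg z
  suffices H : y ≤ 0 from (le_posPart z).trans H
  have hyw : ∀ ε ∈ Eps, y ≤ w * ε := fun ε hε =>
    sup_le (h ε hε) (fmul_nonneg hw (hEps.1 hε))
  apply nonpos_of_forall_le_pow_smul (w := w * y)
  intro m
  set c : ℝ := 2 ^ m with hc
  have hc0 : 0 < c := by positivity
  set u : E := (c • (1 : E) - w)⁺ with hu
  have hu0 : 0 ≤ u := posPart_nonneg _
  have hu1 : u ≤ c • (1 : E) :=
    sup_le (sub_le_self _ hw) (smul_nonneg hc0.le one_nonneg')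
  have huw : u * w ≤ c • u := by
    have h1 : u * (c • (1 : E) - w) = u * u := by
      conv_lhs => rw [← posPart_sub_negPart (c • (1 : E) - w)]
      rw [mul_sub, ← hu, hu, posPart_mul_negPart, sub_zero]
    have h2 : 0 ≤ u * (c • (1 : E) - w) := h1 ▸ fmul_nonneg hu0 hu0
    rw [mul_sub, sub_nonneg, mul_smul_comm, mul_one] at h2
    exact h2
  have huy : u * y ≤ 0 := by
    have h1 : (c⁻¹ * c⁻¹) • (u * y) ≤ 0 := by
      apply hEps.2
      intro ε hε
      have hε0 := hEps.1 hε
      have h2 : u * y ≤ (c * c) • ε := by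
        calc u * y ≤ u * (w * ε) := fmul_le_left hu0 (hyw ε hε)
          _ = u * w * ε := (mul_assoc _ _ _).symm
          _ ≤ (c • u) * ε := fmul_le_right hε0 huw
          _ ≤ (c • (c • (1 : E))) * ε :=
            fmul_le_right hε0 (smul_le_smul_of_nonneg_left hu1 hc0.le)
          _ = (c * c) • ε := by rw [smul_smul, smul_mul_assoc, one_mul]
      have h3 := smul_le_smul_of_nonneg_left h2 (show 0 ≤ c⁻¹ * c⁻¹ by positivity)
      rwa [smul_smul, show c⁻¹ * c⁻¹ * (c * c) = 1 by field_simp, one_smul] at h3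
    have h2 := smul_le_smul_of_nonneg_left h1 (show 0 ≤ c * c by positivity)
    rwa [smul_smul, show c * c * (c⁻¹ * c⁻¹) = 1 by field_simp, one_smul, smul_zero] at h2
  have h1 : (c • (1 : E) - w) * y ≤ 0 := (fmul_le_right hy0 (le_posPart _)).trans huy
  rw [sub_mul, smul_mul_assoc, one_mul, sub_nonpos] at h1
  have h2 := smul_le_smul_of_nonneg_left h1 (show 0 ≤ c⁻¹ by positivity)
  rw [smul_smul, inv_mul_cancel₀ hc0.ne', one_smul] at h2
  simpa [hc] using h2

/-- Expanding `0 ≤ (c • x - 1)²` bounds `c • x` by `1` for arbitrarily large `c`. -/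
theorem eq_zero_of_mul_self {x : E} (hx : 0 ≤ x) (h : x * x = 0) : x = 0 := by
  refine le_antisymm (nonpos_of_forall_le_pow_smul (w := 1) fun n => ?_) hx
  set c : ℝ := 2 ^ n with hc
  have hc0 : 0 < c := by positivity
  have h1 := fmul_self_nonneg (c • x - 1)
  have h2 : (c • x - 1) * (c • x - 1) = 1 - (c • x + c • x) := by
    rw [sub_mul, mul_sub, smul_mul_smul_comm, h, smul_zero, mul_one, one_mul]
    abel
  rw [h2, sub_nonneg] at h1
  have h3 : c • x ≤ 1 := (le_add_of_nonneg_left (smul_nonneg hc0.le hx)).trans h1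
  have h4 := smul_le_smul_of_nonneg_left h3 (show 0 ≤ c⁻¹ by positivity)
  rw [smul_smul, inv_mul_cancel₀ hc0.ne', one_smul] at h4
  simpa [hc] using h4

theorem inf_eq_zero_of_mul_eq_zero {x y : E} (hx : 0 ≤ x) (hy : 0 ≤ y) (h : x * y = 0) :
    x ⊓ y = 0 := by
  have h0 : 0 ≤ x ⊓ y := le_inf hx hy
  refine eq_zero_of_mul_self h0 (le_antisymm ?_ (fmul_nonneg h0 h0))
  calc (x ⊓ y) * (x ⊓ y) ≤ x * (x ⊓ y) := fmul_le_right h0 inf_le_left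
    _ ≤ x * y := fmul_le_left hx inf_le_right
    _ = 0 := h

theorem isWeakOrderUnit_iff {r : E} :
    IsWeakOrderUnit r ↔ 0 ≤ r ∧ ∀ z : E, 0 ≤ z → z * r = 0 → z = 0 := by
  refine and_congr_right fun hr => ⟨fun h z hz hzr => ?_, fun h x hx => ?_⟩
  · exact h z (by rw [abs_of_nonneg hz]; exact inf_eq_zero_of_mul_eq_zero hz hr hzr)
  · exact eq_zero_of_abs_nonpos (h _ (abs_nonneg x) (mul_eq_zero_of_inf_eq_zero hx)).le

theorem IsWeakOrderUnit.mono {r s : E} (hr : IsWeakOrderUnit r) (h : r ≤ s) :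
    IsWeakOrderUnit s := by
  rw [isWeakOrderUnit_iff] at *
  refine ⟨hr.1.trans h, fun z hz hzs => hr.2 z hz (le_antisymm ?_ (fmul_nonneg hz hr.1))⟩
  exact hzs ▸ fmul_le_left hz h

theorem IsWeakOrderUnit.smul {r : E} (hr : IsWeakOrderUnit r) {c : ℝ} (hc : 0 < c) :
    IsWeakOrderUnit (c • r) := by
  rw [isWeakOrderUnit_iff] at *
  refine ⟨smul_nonneg hc.le hr.1, fun z hz hzs => hr.2 z hz ?_⟩
  rw [mul_smul_comm] at hzs
  exact (smul_eq_zero.1 hzs).resolve_left hc.ne'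

/-- The component of the unit in the band generated by a positive element. -/
theorem exists_support {v : E} (hv : 0 ≤ v) : ∃ p : E, IsComponent p ∧ p * v = v ∧
    ∀ z : E, 0 ≤ z → z * v = 0 → p * z = 0 := by
  set S : Set E := Set.range fun n : ℕ => (n • v) ⊓ 1 with hS
  have hub : (1 : E) ∈ upperBounds S := by rintro _ ⟨n, rfl⟩; exact inf_le_right
  have hlub : IsLUB S (sSup S) := isLUB_csSup (Set.range_nonempty _) ⟨1, hub⟩
  set p := sSup S with hp
  have hp1 : p ≤ 1 := hlub.2 hub
  have hle : ∀ d : E, (∀ n : ℕ, (n • v) ⊓ 1 + d ≤ p) → d ≤ 0 := fun d hd => by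
    have : p ≤ p - d := hlub.2 (by rintro _ ⟨n, rfl⟩; exact le_sub_iff_add_le.2 (hd n))
    simpa using this
  have hp0 : 0 ≤ p := by
    refine le_trans ?_ (hlub.1 ⟨0, rfl⟩)
    simpa using one_nonneg'
  have hdisj : ∀ z : E, 0 ≤ z → z ⊓ v = 0 → z ⊓ p = 0 := fun z hz hzv => by
    refine le_antisymm (hle _ fun n => ?_) (le_inf hz hp0)
    have hn : (n • v) ⊓ z = 0 := by
      rw [show n • v = (n • (1 : E)) * v by rw [smul_mul_assoc, one_mul]]
      rw [inf_comm] at hzv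
      exact IsFAlgebra.left_disjoint _ _ _ hzv (nsmul_nonneg one_nonneg' n)
    have h0 : ((n • v) ⊓ 1) ⊓ (z ⊓ p) = 0 := by
      refine le_antisymm ?_ (le_inf (le_inf (nsmul_nonneg hv n) one_nonneg') (le_inf hz hp0))
      rw [← hn]
      exact inf_le_inf inf_le_left inf_le_left
    rw [← inf_add_sup, h0, zero_add]
    exact sup_le (hlub.1 ⟨n, rfl⟩) inf_le_right
  -- Adding `(1 - p) ⊓ v` to `(n • v) ⊓ 1` stays below `((n + 1) • v) ⊓ 1`, hence below the supremum
  -- `p`.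
  have hcv : (1 - p) ⊓ v = 0 := by
    refine le_antisymm (hle _ fun n => ?_) (le_inf (sub_nonneg.2 hp1) hv)
    refine le_trans (le_inf ?_ ?_) (hlub.1 ⟨n + 1, rfl⟩)
    · simp only [add_smul, one_smul]
      exact add_le_add inf_le_left inf_le_right
    · calc (n • v) ⊓ 1 + (1 - p) ⊓ v ≤ p + (1 - p) :=
            add_le_add (hlub.1 ⟨n, rfl⟩) inf_le_left
        _ = 1 := by abel
  have hcomp : IsComponent p := by
    have := hdisj _ (sub_nonneg.2 hp1) hcv
    rwa [inf_comm] at this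
  refine ⟨p, hcomp, ?_, fun z hz hzv => ?_⟩
  · have := mul_eq_zero_of_inf_eq_zero hcv
    rw [sub_mul, one_mul, sub_eq_zero] at this
    exact this.symm
  · rw [hcomp.comm]
    exact mul_eq_zero_of_inf_eq_zero (hdisj z hz (inf_eq_zero_of_mul_eq_zero hz hv hzv))

theorem exists_sign (x : E) : ∃ p : E, IsComponent p ∧ 0 ≤ p * x ∧ (1 - p) * x ≤ 0 := by
  obtain ⟨p, hp, h1, h2⟩ := exists_support (posPart_nonneg x)
  have h3 : p * x⁻ = 0 := h2 _ (negPart_nonneg x) (negPart_mul_posPart x)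
  have h4 : p * x = x⁺ := by
    conv_lhs => rw [← posPart_sub_negPart x]
    rw [mul_sub, h1, h3, sub_zero]
  refine ⟨p, hp, h4 ▸ posPart_nonneg x, ?_⟩
  rw [sub_mul, one_mul, h4, sub_nonpos]
  exact le_posPart x

end Dedekind

/-! ### Order limits of sequences, nested intervals and intermediate values. -/

section Sequences

variable {E : Type*} [Ring E] [ConditionallyCompleteLattice E] [IsOrderedAddMonoid E]
  [Algebra ℝ E] [IsOrderedModule ℝ E]

theorem OrderConverges.nonpos {x : ℕ → E} {l : E} (h : OrderConverges x l) (hx : ∀ n, x n ≤ 0) :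
    l ≤ 0 := by
  obtain ⟨Eps, hEps, H⟩ := h
  apply hEps.2
  intro ε hε
  obtain ⟨N, hN⟩ := H ε hε
  have h1 := (neg_le_abs _).trans (hN N le_rfl)
  rw [neg_sub] at h1
  exact (sub_le_iff_le_add.1 h1).trans (add_le_of_nonpos_right (hx N))

theorem OrderConverges.neg {x : ℕ → E} {l : E} (h : OrderConverges x l) :
    OrderConverges (fun n => -x n) (-l) := by
  obtain ⟨Eps, hEps, H⟩ := h
  refine ⟨Eps, hEps, fun ε hε => ?_⟩
  obtain ⟨N, hN⟩ := H ε hε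
  refine ⟨N, fun n hn => ?_⟩
  rw [← neg_sub', abs_neg]
  exact hN n hn

theorem OrderConverges.nonneg {x : ℕ → E} {l : E} (h : OrderConverges x l) (hx : ∀ n, 0 ≤ x n) :
    0 ≤ l :=
  neg_nonpos.1 (h.neg.nonpos fun n => neg_nonpos.2 (hx n))

theorem OrderConverges.sub {x y : ℕ → E} {l m : E} (hx : OrderConverges x l)
    (hy : OrderConverges y m) : OrderConverges (fun n => x n - y n) (l - m) := by
  obtain ⟨A, hA, HA⟩ := hx
  obtain ⟨B, hB, HB⟩ := hy
  refine ⟨Set.image2 (· + ·) A B, ⟨?_, fun z hz => ?_⟩, ?_⟩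
  · rintro _ ⟨α, hα, β, hβ, rfl⟩
    exact add_nonneg (hA.1 hα) (hB.1 hβ)
  · refine hB.2 fun β hβ => ?_
    have : z - β ≤ 0 := hA.2 fun α hα => sub_le_iff_le_add.2 (hz ⟨α, hα, β, hβ, rfl⟩)
    exact sub_nonpos.1 this
  · rintro _ ⟨α, hα, β, hβ, rfl⟩
    obtain ⟨M, hM⟩ := HA α hα
    obtain ⟨N, hN⟩ := HB β hβ
    refine ⟨max M N, fun n hn => ?_⟩
    rw [sub_sub_sub_comm, sub_eq_add_neg]
    refine (abs_add_le _ _).trans ?_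
    rw [abs_neg]
    exact add_le_add (hM n (le_of_max_le_left hn)) (hN n (le_of_max_le_right hn))

theorem orderConverges_const (l : E) : OrderConverges (fun _ : ℕ => l) l :=
  ⟨{0}, isGLB_singleton, fun ε hε => ⟨0, fun _ _ => by
    rw [Set.mem_singleton_iff.1 hε, sub_self, abs_zero]⟩⟩

theorem OrderConverges.unique {x : ℕ → E} {l m : E} (hl : OrderConverges x l)
    (hm : OrderConverges x m) : l = m := by
  have h := hl.sub hm
  refine le_antisymm (sub_nonpos.1 (h.nonpos fun n => ?_)) (sub_nonneg.1 (h.nonneg fun n => ?_))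
  all_goals simp

theorem OrderConverges.component_mul [IsFAlgebra E] {x : ℕ → E} {l p : E} (hp : IsComponent p)
    (h : OrderConverges x l) : OrderConverges (fun n => p * x n) (p * l) := by
  obtain ⟨Eps, hEps, H⟩ := h
  refine ⟨Eps, hEps, fun ε hε => ?_⟩
  obtain ⟨N, hN⟩ := H ε hε
  refine ⟨N, fun n hn => ?_⟩
  rw [← mul_sub, abs_mul_of_nonneg hp.nonneg]
  refine (fmul_le_right (abs_nonneg _) (sub_nonneg.1 hp.compl_nonneg)).trans ?_
  rw [one_mul]
  exact hN n hn

/-- Continuity of `g` on `D` along sequences that converge geometrically. -/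
def GeomContOn (g : E → E) (D : Set E) : Prop :=
  ∀ (x : ℕ → E) (l v : E), (∀ n, x n ∈ D) → l ∈ D → (∀ n, |x n - l| ≤ (1 / 2 : ℝ) ^ n • v) →
    OrderConverges (fun n => g (x n)) (g l)

theorem GeomContOn.mono {g : E → E} {D D' : Set E} (hg : GeomContOn g D) (h : D' ⊆ D) :
    GeomContOn g D' :=
  fun x l v hx hl => hg x l v (fun n => h (hx n)) (h hl)

theorem LocalOn.mono {g : E → E} {D D' : Set E} (hg : LocalOn g D) (h : D' ⊆ D) :
    LocalOn g D' :=
  fun p hp x hx y hy => hg p hp x (h hx) y (h hy)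

/-- The increment of `f` over a step `c`, reduced by `d`. -/
def increment (f : E → E) (c d : E) : E → E := fun x => f (x + c) - f x - d

theorem GeomContOn.increment {f : E → E} {D D' : Set E} (hf : GeomContOn f D) {c d : E}
    (h1 : ∀ x ∈ D', x ∈ D) (h2 : ∀ x ∈ D', x + c ∈ D) :
    GeomContOn (increment f c d) D' := by
  intro x l v hx hl hxl
  refine ((hf (fun n => x n + c) (l + c) v (fun n => h2 _ (hx n)) (h2 _ hl) fun n => ?_).sub
    (hf x l v (fun n => h1 _ (hx n)) (h1 _ hl) hxl)).sub (orderConverges_const d)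
  rw [add_sub_add_right_eq_sub]
  exact hxl n

theorem LocalOn.increment [IsFAlgebra E] {f : E → E} {D D' : Set E} (hf : LocalOn f D) {c d : E}
    (h1 : ∀ x ∈ D', x ∈ D) (h2 : ∀ x ∈ D', x + c ∈ D) :
    LocalOn (increment f c d) D' := by
  intro p hp x hx y hy hxy
  unfold OrderCalculus.increment
  rw [mul_sub, mul_sub, mul_sub, mul_sub, hf p hp x (h1 x hx) y (h1 y hy) hxy,
    hf p hp _ (h2 x hx) _ (h2 y hy) (by rw [mul_add, mul_add, hxy])]

/-- The reflection flips the sign of `g` on `1 - p`. Being an involution, it preserves zeros, so end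
values can be given the signs that bisection needs. -/
theorem GeomContOn.refl_mul [IsFAlgebra E] {g : E → E} {D : Set E} (hg : GeomContOn g D) {p : E}
    (hp : IsComponent p) : GeomContOn (fun x => (p - (1 - p)) * g x) D := by
  intro x l v hx hl hxl
  simp only [sub_mul p (1 - p)]
  exact ((hg x l v hx hl hxl).component_mul hp).sub ((hg x l v hx hl hxl).component_mul hp.compl)

theorem LocalOn.refl_mul [IsFAlgebra E] {g : E → E} {D : Set E} (hg : LocalOn g D) (p : E) :
    LocalOn (fun x => (p - (1 - p)) * g x) D := by
  intro q hq x hx y hy hxy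
  simp only
  rw [← mul_assoc, hq.comm, mul_assoc, hg q hq x hx y hy hxy, ← mul_assoc, ← hq.comm, mul_assoc]

/-- Nested intervals of geometrically decreasing length have a common point. -/
theorem exists_nested {P : ℕ → E → Prop} {w s₀ : E} (hw : 0 ≤ w) (h0 : P 0 s₀)
    (step : ∀ n s, P n s → ∃ s', P (n + 1) s' ∧ s ≤ s' ∧
      s' + (1 / 2 : ℝ) ^ (n + 1) • w ≤ s + (1 / 2 : ℝ) ^ n • w) :
    ∃ (s : ℕ → E) (x : E), s 0 = s₀ ∧
      ∀ n, P n (s n) ∧ s n ≤ x ∧ x ≤ s n + (1 / 2 : ℝ) ^ n • w := by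
  choose! F hF1 hF2 hF3 using step
  let s : ℕ → E := fun n => Nat.rec s₀ F n
  have hP : ∀ n, P n (s n) := fun n => by
    induction n with
    | zero => exact h0
    | succ n ih => exact hF1 n _ ih
  have hmono : Monotone s := monotone_nat_of_le_succ fun n => hF2 n _ (hP n)
  have hanti : Antitone fun n => s n + (1 / 2 : ℝ) ^ n • w :=
    antitone_nat_of_succ_le fun n => hF3 n _ (hP n)
  have hle : ∀ m n, s m ≤ s n + (1 / 2 : ℝ) ^ n • w := fun m n =>
    (hmono (le_max_left m n)).trans
      ((le_add_of_nonneg_right (pow_half_smul_nonneg _ hw)).trans (hanti (le_max_right m n)))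
  have hlub : IsLUB (Set.range s) (sSup (Set.range s)) :=
    isLUB_csSup (Set.range_nonempty _) ⟨_, by rintro _ ⟨m, rfl⟩; exact hle m 0⟩
  refine ⟨s, sSup (Set.range s), rfl, fun n => ⟨hP n, hlub.1 ⟨n, rfl⟩, hlub.2 ?_⟩⟩
  rintro _ ⟨m, rfl⟩
  exact hle m n

variable [IsFAlgebra E]

/-- The intermediate value theorem for local functions. -/
theorem exists_eq_zero {g : E → E} {a b : E} (hab : a ≤ b) (hloc : LocalOn g (Set.Icc a b))
    (hcont : GeomContOn g (Set.Icc a b)) (ha : g a ≤ 0) (hb : 0 ≤ g b) :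
    ∃ x ∈ Set.Icc a b, g x = 0 := by
  set w := b - a with hw
  have hw0 : 0 ≤ w := sub_nonneg.2 hab
  obtain ⟨s, x, h0, hs⟩ := exists_nested (w := w) (s₀ := a)
    (P := fun n s => s ∈ Set.Icc a b ∧ s + (1 / 2 : ℝ) ^ n • w ∈ Set.Icc a b ∧ g s ≤ 0 ∧
      0 ≤ g (s + (1 / 2 : ℝ) ^ n • w)) hw0
    (by simpa [hw, hab] using ⟨ha, hb⟩) (by
      rintro n s ⟨hs, ht, hgs, hgt⟩
      set d := (1 / 2 : ℝ) ^ (n + 1) • w with hd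
      have hd0 : 0 ≤ d := pow_half_smul_nonneg _ hw0
      have hdd : (1 / 2 : ℝ) ^ n • w = d + d := by rw [← two_smul ℝ d, pow_half_smul_succ]
      rw [hdd, ← add_assoc] at ht hgt ⊢
      have h1 : s ≤ s + d := le_add_of_nonneg_right hd0
      have h2 : s + d ≤ s + d + d := le_add_of_nonneg_right hd0
      have hm : s + d ∈ Set.Icc a b := ⟨hs.1.trans h1, h2.trans ht.2⟩
      -- Both halves are used at once: the left half on `p`, where the midpoint value is
      -- nonnegative, and the right half on `1 - p`.
      obtain ⟨p, hp, hp1, hp2⟩ := exists_sign (g (s + d))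
      have he : p * s + (1 - p) * (s + d) + d = p * (s + d) + (1 - p) * (s + d + d) := by
        noncomm_ring
      refine ⟨p * s + (1 - p) * (s + d), ⟨hp.mix_mem_Icc hs hm, ?_, ?_, ?_⟩, ?_, ?_⟩
      · rw [he]; exact hp.mix_mem_Icc hm ht
      · rw [hloc.map_mix hp hs hm]
        refine add_nonpos ?_ hp2
        simpa using fmul_le_left hp.nonneg hgs
      · rw [he, hloc.map_mix hp hm ht]
        exact add_nonneg hp1 (fmul_nonneg hp.compl_nonneg hgt)
      · exact (hp.mix_mem_Icc ⟨le_rfl, h1⟩ ⟨h1, le_rfl⟩).1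
      · rw [he]
        exact (hp.mix_mem_Icc (l := s + d) ⟨le_rfl, h2⟩ ⟨h2, le_rfl⟩).2)
  have hx : x ∈ Set.Icc a b := by
    have := hs 0
    rw [h0] at this
    refine ⟨this.2.1, this.2.2.trans ?_⟩
    simp [hw]
  refine ⟨x, hx, le_antisymm ?_ ?_⟩
  · refine (hcont s x w (fun n => (hs n).1.1) hx fun n => ?_).nonpos fun n => (hs n).1.2.2.1
    rw [abs_sub_comm, abs_of_nonneg (sub_nonneg.2 (hs n).2.1), sub_le_iff_le_add']
    exact (hs n).2.2
  · refine (hcont (fun n => s n + (1 / 2 : ℝ) ^ n • w) x w (fun n => (hs n).1.2.1) hx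
      fun n => ?_).nonneg fun n => (hs n).1.2.2.2
    rw [abs_of_nonneg (sub_nonneg.2 (hs n).2.2), sub_le_iff_le_add']
    exact add_le_add_left (hs n).2.1 _

end Sequences

theorem OrderContinuous.geomContOn {E : Type u} [Ring E] [ConditionallyCompleteLattice E]
    [IsOrderedAddMonoid E] [Algebra ℝ E] [IsOrderedModule ℝ E] {f : E → E} {D : Set E}
    (hf : OrderContinuous f D) : GeomContOn f D := by
  intro x l v hx hl hxl
  have hv : 0 ≤ v := (abs_nonneg _).trans (by simpa using hxl 0)
  obtain ⟨Eps, hEps, H⟩ := hf l hl (ULift.{u} ℕ) (fun n => x n.down) (fun n => hx _)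
    ⟨_, (downZero_pow_smul hv).1, by
      rintro _ ⟨n, rfl⟩
      exact ⟨⟨n⟩, fun m hm => (hxl _).trans (pow_half_smul_anti hm hv)⟩⟩
  refine ⟨Eps, hEps, fun ε hε => ?_⟩
  obtain ⟨N, hN⟩ := H ε hε
  exact ⟨N.down, fun n hn => hN ⟨n⟩ hn⟩

/-! ### Locality of differentiable functions and halving of increments. -/

section MeanValue

variable {E : Type*} [Ring E] [ConditionallyCompleteLattice E] [IsOrderedAddMonoid E]
  [Algebra ℝ E] [IsOrderedModule ℝ E] [IsFAlgebra E]

theorem abs_smul_of_nonneg {c : ℝ} (hc : 0 ≤ c) (x : E) : |c • x| = c • |x| := by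
  have := abs_mul_of_nonneg (smul_nonneg hc (one_nonneg' (E := E))) x
  simpa using this

theorem abs_sub_le_of_mem_Icc {a b x y : E} (hx : x ∈ Set.Icc a b) (hy : y ∈ Set.Icc a b) :
    |x - y| ≤ b - a := by
  refine sup_le (sub_le_sub hx.2 hy.1) ?_
  rw [neg_sub]
  exact sub_le_sub hy.2 hx.1

theorem openInterval_subset_Icc {a b : E} : openInterval a b ⊆ Set.Icc a b :=
  fun _ hx => ⟨sub_nonneg.1 hx.1.1, sub_nonneg.1 hx.2.1⟩

theorem add_smul_midpoint_sub_mem {a b z : E} (hab : WLt a b) (hz : z ∈ Set.Icc a b) {s : ℝ}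
    (h0 : 0 < s) (h1 : s ≤ 1) : z + s • ((1 / 2 : ℝ) • (a + b) - z) ∈ openInterval a b := by
  have hs : 0 ≤ 1 - s := sub_nonneg.2 h1
  have hu : IsWeakOrderUnit ((s / 2) • (b - a)) := hab.smul (by positivity)
  constructor
  · refine hu.mono ?_
    have : z + s • ((1 / 2 : ℝ) • (a + b) - z) - a = (s / 2) • (b - a) + (1 - s) • (z - a) := by
      module
    rw [this]
    exact le_add_of_nonneg_right (smul_nonneg hs (sub_nonneg.2 hz.1))
  · refine hu.mono ?_
    have : b - (z + s • ((1 / 2 : ℝ) • (a + b) - z)) = (s / 2) • (b - a) + (1 - s) • (b - z) := by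
      module
    rw [this]
    exact le_add_of_nonneg_right (smul_nonneg hs (sub_nonneg.2 hz.2))

theorem add_smul_sub_mem_Icc {a b x y : E} (hx : x ∈ Set.Icc a b) (hy : y ∈ Set.Icc a b) {t : ℝ}
    (h0 : 0 ≤ t) (h1 : t ≤ 1) : x + t • (y - x) ∈ Set.Icc a b := by
  have ht : 0 ≤ 1 - t := sub_nonneg.2 h1
  constructor
  · rw [← sub_nonneg, show x + t • (y - x) - a = (1 - t) • (x - a) + t • (y - a) by module]
    exact add_nonneg (smul_nonneg ht (sub_nonneg.2 hx.1)) (smul_nonneg h0 (sub_nonneg.2 hy.1))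
  · rw [← sub_nonneg, show b - (x + t • (y - x)) = (1 - t) • (b - x) + t • (b - y) by module]
    exact add_nonneg (smul_nonneg ht (sub_nonneg.2 hx.2)) (smul_nonneg h0 (sub_nonneg.2 hy.2))

/-- A super order differentiable function is local near each point. -/
theorem HasSuperOrderDerivAt.exists_local {f : E → E} {D : Set E} {c d : E}
    (hf : HasSuperOrderDerivAt f D c d) {w : E} (hw : 0 ≤ w) :
    ∃ n : ℕ, ∀ p, IsComponent p → ∀ z ∈ D, |z - c| ≤ (1 / 2 : ℝ) ^ n • w → p * z = p * c →
      p * f z = p * f c := by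
  obtain ⟨Eps, hEps, H⟩ := hf.2 _ (downZero_pow_smul hw)
  -- The empty set has infimum `0` only if `E` is trivial.
  rcases Eps.eq_empty_or_nonempty with rfl | ⟨ε, hε⟩
  · have hle : ∀ x : E, x ≤ 0 := fun x => hEps.2 (by simp)
    have h0 : ∀ x : E, x = 0 := fun x => le_antisymm (hle x) (neg_nonpos.1 (hle (-x)))
    exact ⟨0, fun p _ z _ _ _ => (h0 _).trans (h0 _).symm⟩
  obtain ⟨_, ⟨n, rfl⟩, hn⟩ := H ε hε
  refine ⟨n, fun p hp z hz hzc hpz => ?_⟩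
  have h1 := fmul_le_left hp.nonneg (hn z hz hzc)
  rw [← abs_mul_of_nonneg hp.nonneg, ← mul_assoc, ← abs_mul_of_nonneg hp.nonneg,
    mul_sub p z c, hpz, sub_self, abs_zero, zero_mul] at h1
  have h2 := eq_zero_of_abs_nonpos h1
  rwa [mul_sub, ← mul_assoc, mul_sub p z c, hpz, sub_self, zero_mul, sub_zero, mul_sub,
    sub_eq_zero] at h2

/-- Along the segment the `p`-part of the argument is constant, so local agreement makes `p * f`
locally constant in the real parameter, and the unit interval is connected. -/
theorem mul_eq_mul_of_segment {f f' : E → E} {a b : E}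
    (hf' : ∀ c ∈ openInterval a b, HasSuperOrderDerivAt f (Set.Icc a b) c (f' c)) {p x y : E}
    (hp : IsComponent p) (hseg : ∀ t ∈ unitInterval, x + t • (y - x) ∈ openInterval a b)
    (hpxy : p * x = p * y) : p * f x = p * f y := by
  set γ : unitInterval → E := fun t => x + (t : ℝ) • (y - x) with hγ
  have hpγ : ∀ t, p * γ t = p * x := fun t => by
    rw [hγ]
    simp only [mul_add, mul_smul_comm, mul_sub, hpxy, sub_self, smul_zero, add_zero]
  have hloc : IsLocallyConstant fun t => p * f (γ t) := by
    rw [IsLocallyConstant.iff_eventually_eq]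
    intro t₀
    obtain ⟨n, hn⟩ := (hf' _ (hseg t₀ t₀.2)).exists_local (abs_nonneg (y - x))
    have hball : Metric.ball t₀ ((1 / 2 : ℝ) ^ n) ∈ nhds t₀ :=
      Metric.ball_mem_nhds _ (by positivity)
    filter_upwards [hball] with t ht
    refine hn p hp _ (openInterval_subset_Icc (hseg t t.2)) ?_ ((hpγ t).trans (hpγ t₀).symm)
    rw [show x + (t : ℝ) • (y - x) - (x + (t₀ : ℝ) • (y - x)) = ((t : ℝ) - t₀) • (y - x) by module]
    rw [Metric.mem_ball, Subtype.dist_eq, Real.dist_eq] at ht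
    refine le_trans ?_ (smul_le_smul_of_nonneg_right ht.le (abs_nonneg (y - x)))
    rcases abs_choice ((t : ℝ) - t₀) with h | h
    · rw [h, abs_smul_of_nonneg (h ▸ abs_nonneg _)]
    · rw [← abs_neg (((t : ℝ) - t₀) • (y - x)), ← neg_smul, h,
        abs_smul_of_nonneg (h ▸ abs_nonneg _)]
  have := hloc.apply_eq_of_preconnectedSpace 0 1
  simpa [hγ] using this

/-- Differentiability is available only inside, so both points are contracted towards the midpoint
of `[a, b]`. The segment between the contracted points stays in `(a, b)`, and continuity carries the
equality to the limit. -/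
theorem localOn_of_hasSuperOrderDerivAt {f f' : E → E} {a b : E} (hab : WLt a b)
    (hf : GeomContOn f (Set.Icc a b))
    (hf' : ∀ c ∈ openInterval a b, HasSuperOrderDerivAt f (Set.Icc a b) c (f' c)) :
    LocalOn f (Set.Icc a b) := by
  intro p hp x hx y hy hxy
  set c : E := (1 / 2 : ℝ) • (a + b) with hc
  set S : E → ℕ → E := fun z n => z + (1 / 2 : ℝ) ^ n • (c - z) with hS
  have hpow0 : ∀ n : ℕ, 0 < (1 / 2 : ℝ) ^ n := fun n => by positivity
  have hpow1 : ∀ n : ℕ, (1 / 2 : ℝ) ^ n ≤ 1 := fun n => pow_le_one₀ (by norm_num) (by norm_num)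
  have hSmem : ∀ z ∈ Set.Icc a b, ∀ n, S z n ∈ openInterval a b := fun z hz n =>
    add_smul_midpoint_sub_mem hab hz (hpow0 n) (hpow1 n)
  have hcmem : c ∈ Set.Icc a b := by
    have := hSmem x hx 0
    simp only [hS, pow_zero, one_smul, add_sub_cancel] at this
    exact openInterval_subset_Icc this
  have hconv : ∀ z ∈ Set.Icc a b, OrderConverges (fun n => p * f (S z n)) (p * f z) :=
    fun z hz => (hf (S z) z (b - a) (fun n => openInterval_subset_Icc (hSmem z hz n)) hz
      fun n => by
        rw [hS]
        simp only [add_sub_cancel_left]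
        rw [abs_smul_of_nonneg (hpow0 n).le]
        exact smul_le_smul_of_nonneg_left (abs_sub_le_of_mem_Icc hcmem hz) (hpow0 n).le
        ).component_mul hp
  have heq : ∀ n, p * f (S x n) = p * f (S y n) := fun n => by
    refine mul_eq_mul_of_segment hf' hp (fun t ht => ?_) ?_
    · have := hSmem _ (add_smul_sub_mem_Icc hx hy ht.1 ht.2) n
      convert this using 1
      simp only [hS]
      module
    · simp only [hS, mul_add, mul_smul_comm, mul_sub, hxy]
  have h := hconv x hx
  simp only [heq] at h
  exact h.unique (hconv y hy)

theorem IsComponent.mul {p q : E} (hp : IsComponent p) (hq : IsComponent q) :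
    IsComponent (p * q) := by
  apply inf_eq_zero_of_mul_eq_zero (fmul_nonneg hp.nonneg hq.nonneg)
  · rw [show 1 - p * q = (1 - p) + p * (1 - q) by noncomm_ring]
    exact add_nonneg hp.compl_nonneg (fmul_nonneg hp.nonneg hq.compl_nonneg)
  · rw [mul_sub, mul_one, mul_assoc, ← mul_assoc q, ← hp.comm q, mul_assoc, hq.mul_self,
      hp.mul_mul_self, sub_self]

/-- The reduced increments over the two halves are opposite, so after a reflection the intermediate
value theorem applies between their left ends. -/
theorem exists_increment_half {f : E → E} {a b : E} (hloc : LocalOn f (Set.Icc a b))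
    (hcont : GeomContOn f (Set.Icc a b)) {s d c : E} (hd : 0 ≤ d) (hs : s ∈ Set.Icc a b)
    (ht : s + d + d ∈ Set.Icc a b) (h : f (s + d + d) - f s = c + c) :
    ∃ x ∈ Set.Icc s (s + d), f (x + d) - f x = c := by
  have h1 : s ≤ s + d := le_add_of_nonneg_right hd
  have h2 : s + d ≤ s + d + d := le_add_of_nonneg_right hd
  have hD1 : ∀ x ∈ Set.Icc s (s + d), x ∈ Set.Icc a b := fun x hx =>
    ⟨hs.1.trans hx.1, hx.2.trans (h2.trans ht.2)⟩
  have hD2 : ∀ x ∈ Set.Icc s (s + d), x + d ∈ Set.Icc a b := fun x hx =>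
    ⟨hs.1.trans (hx.1.trans (le_add_of_nonneg_right hd)),
      (add_le_add_left hx.2 d).trans ht.2⟩
  set k := increment f d c with hk
  have hsum : k s = -k (s + d) := by
    simp only [hk, increment]
    rw [eq_neg_iff_add_eq_zero]
    calc f (s + d) - f s - c + (f (s + d + d) - f (s + d) - c)
        = f (s + d + d) - f s - (c + c) := by abel
      _ = 0 := by rw [h, sub_self]
  obtain ⟨p, hp, hp1, hp2⟩ := exists_sign (k (s + d))
  have hpos : 0 ≤ (p - (1 - p)) * k (s + d) := by
    rw [sub_mul p, sub_nonneg]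
    exact hp2.trans hp1
  obtain ⟨x, hx, hx0⟩ := exists_eq_zero h1 ((hloc.increment hD1 hD2).refl_mul p)
    ((hcont.increment hD1 hD2).refl_mul hp)
    (by rw [← hk, hsum, mul_neg, neg_nonpos]; exact hpos) hpos
  refine ⟨x, hx, ?_⟩
  have := congrArg ((p - (1 - p)) * ·) hx0
  simp only [hp.refl_mul_refl_mul, mul_zero] at this
  exact sub_eq_zero.1 this

end MeanValue

/-! ### Zeros well inside an interval. -/

section MeanValue

variable {E : Type*} [Ring E] [ConditionallyCompleteLattice E] [IsOrderedAddMonoid E]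
  [Algebra ℝ E] [IsOrderedModule ℝ E] [IsFAlgebra E]

/-- A weak order unit on a component, glued to a faithful element on the complement. -/
theorem IsWeakOrderUnit.mix {p u h : E} (hp : IsComponent p) (hu : 0 ≤ u) (hpu : p * u = u)
    (hpz : ∀ z : E, 0 ≤ z → z * u = 0 → p * z = 0) (hh : IsWeakOrderUnit h) :
    IsWeakOrderUnit (p * u + (1 - p) * h) := by
  rw [isWeakOrderUnit_iff] at *
  have h1 : 0 ≤ p * u := hpu.symm ▸ hu
  have h2 : 0 ≤ (1 - p) * h := fmul_nonneg hp.compl_nonneg hh.1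
  refine ⟨add_nonneg h1 h2, fun z hz hz0 => ?_⟩
  rw [mul_add, add_eq_zero_iff_of_nonneg (fmul_nonneg hz h1) (fmul_nonneg hz h2), hpu] at hz0
  have h3 : (1 - p) * z = 0 := by
    apply hh.2 _ (fmul_nonneg hp.compl_nonneg hz)
    rw [mul_assoc, ← hp.compl.left_comm]
    exact hz0.2
  exact hp.ext_of (by rw [hpz z hz hz0.1, mul_zero]) (by rw [h3, mul_zero])

/-- A local function whose values at three equidistant points sum to zero vanishes at a point
well inside the interval that they span. -/
theorem exists_interior_eq_zero {k : E → E} {a h : E} (hh : IsWeakOrderUnit h)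
    (hloc : LocalOn k (Set.Icc a (a + h + h))) (hcont : GeomContOn k (Set.Icc a (a + h + h)))
    (hsum : k a + k (a + h) + k (a + h + h) = 0) :
    ∃ x, WLt a x ∧ WLt x (a + h + h) ∧ k x = 0 := by
  have hh0 := hh.1
  have le1 : a ≤ a + h := le_add_of_nonneg_right hh0
  have le2 : a + h ≤ a + h + h := le_add_of_nonneg_right hh0
  have m0 : a ∈ Set.Icc a (a + h + h) := ⟨le_rfl, le1.trans le2⟩
  have m1 : a + h ∈ Set.Icc a (a + h + h) := ⟨le1, le2⟩
  have m2 : a + h + h ∈ Set.Icc a (a + h + h) := ⟨le1.trans le2, le_rfl⟩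
  obtain ⟨p, hp, hp1, hp2⟩ := exists_sign (k (a + h))
  set K : E → E := fun x => (p - (1 - p)) * k x with hK
  have hKloc : LocalOn K (Set.Icc a (a + h + h)) := hloc.refl_mul p
  have hKcont : GeomContOn K (Set.Icc a (a + h + h)) := hcont.refl_mul hp
  have hK1 : 0 ≤ K (a + h) := by
    simp only [hK]
    rw [sub_mul p, sub_nonneg]
    exact hp2.trans hp1
  have hKsum : K a + K (a + h) + K (a + h + h) = 0 := by
    simp only [hK]
    rw [← mul_add, ← mul_add, hsum, mul_zero]
  have hKk : ∀ x, K x = 0 → k x = 0 := fun x hx => by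
    have := congrArg ((p - (1 - p)) * ·) hx
    simpa only [hK, hp.refl_mul_refl_mul, mul_zero] using this
  clear_value K
  -- The smaller end value is at `a` on `r`, at `a + h + h` on `1 - r`. As the three values sum to
  -- zero, `K (a + h)` is at most minus twice that smaller value, so there is a sign change between
  -- that end and the middle.
  obtain ⟨r, hr, hr1, hr2⟩ := exists_sign (K (a + h + h) - K a)
  have hneg : ∀ A B C : E, A + B + C = 0 → A ≤ C → B ≤ -(A + A) := fun A B C h hAC => by
    rw [show B = -(A + C) by rw [eq_neg_iff_add_eq_zero, ← h]; abel]
    exact neg_le_neg (add_le_add_right hAC A)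
  have hra : r * K (a + h) ≤ -(r * K a + r * K a) := by
    rw [mul_sub, sub_nonneg] at hr1
    exact hneg _ _ _ (by rw [← mul_add, ← mul_add, hKsum, mul_zero]) hr1
  have hrb : (1 - r) * K (a + h) ≤ -((1 - r) * K (a + h + h) + (1 - r) * K (a + h + h)) := by
    rw [mul_sub, sub_nonpos] at hr2
    refine hneg _ _ _ ?_ hr2
    rw [← mul_add, ← mul_add, add_right_comm, add_comm (K (a + h + h)), add_right_comm, hKsum,
      mul_zero]
  have hr10 : 0 ≤ r * K (a + h) := fmul_nonneg hr.nonneg hK1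
  have hr11 : 0 ≤ (1 - r) * K (a + h) := fmul_nonneg hr.compl_nonneg hK1
  have hdbl : ∀ z : E, 0 ≤ -(z + z) → z ≤ 0 := fun z hz => by
    rw [neg_nonneg, ← two_smul ℝ] at hz
    have := smul_le_smul_of_nonneg_left hz (show (0 : ℝ) ≤ 1 / 2 by norm_num)
    rwa [smul_smul, smul_zero, show (1 / 2 : ℝ) * 2 = 1 by norm_num, one_smul] at this
  have hra0 : r * K a ≤ 0 := hdbl _ (hr10.trans hra)
  have hrb0 : (1 - r) * K (a + h + h) ≤ 0 := hdbl _ (hr11.trans hrb)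
  -- a zero between the points `s ≤ t` at which `K` has opposite signs
  set s := r * a + (1 - r) * (a + h) with hs
  set t := r * (a + h) + (1 - r) * (a + h + h) with ht
  have hsm : s ∈ Set.Icc a (a + h + h) := hr.mix_mem_Icc m0 m1
  have htm : t ∈ Set.Icc a (a + h + h) := hr.mix_mem_Icc m1 m2
  have hst : s ≤ t := add_le_add (fmul_le_left hr.nonneg le1) (fmul_le_left hr.compl_nonneg le2)
  have hsub : Set.Icc s t ⊆ Set.Icc a (a + h + h) := Set.Icc_subset_Icc hsm.1 htm.2
  obtain ⟨x, hx, hx0⟩ := exists_eq_zero hst ((hKloc.mono hsub).refl_mul r)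
    ((hKcont.mono hsub).refl_mul hr)
    (by
      rw [hs, hKloc.map_mix hr m0 m1, sub_mul r, hr.mul_mix, hr.compl_mul_mix, sub_nonpos]
      exact hra0.trans hr11)
    (by
      rw [ht, hKloc.map_mix hr m1 m2, sub_mul r, hr.mul_mix, hr.compl_mul_mix, sub_nonneg]
      exact hrb0.trans hr10)
  have hKx : K x = 0 := by
    have := congrArg ((r - (1 - r)) * ·) hx0
    simpa only [hr.refl_mul_refl_mul, mul_zero] using this
  have hxm := hsub hx
  have hx1 : r * x ≤ r * (a + h) := by
    simpa [ht, hr.mul_mix] using fmul_le_left hr.nonneg hx.2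
  have hx2 : (1 - r) * (a + h) ≤ (1 - r) * x := by
    simpa only [hs, hr.compl_mul_mix] using fmul_le_left hr.compl_nonneg hx.1
  -- the component on which `x` touches the end points
  set u := r * (x - a) + (1 - r) * (a + h + h - x) with hu
  have hu0 : 0 ≤ u := add_nonneg (fmul_nonneg hr.nonneg (sub_nonneg.2 hxm.1))
    (fmul_nonneg hr.compl_nonneg (sub_nonneg.2 hxm.2))
  obtain ⟨π, hπ, hπu, hπz⟩ := exists_support hu0
  -- On `1 - π` the zero `x` sits at the chosen end, so `K` vanishes there. The bounds `hra` and
  -- `hrb` then force `K (a + h)` to vanish on `1 - π` too.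
  have hqu : (1 - π) * u = 0 := by rw [sub_mul, one_mul, hπu, sub_self]
  have hq1 : (1 - π) * (r * K (a + h)) = 0 := by
    have h1 : (1 - π) * r * x = (1 - π) * r * a := by
      rw [← sub_eq_zero, ← mul_sub, mul_assoc, ← hr.mul_mix (x - a) (a + h + h - x), ← hu,
        hr.left_comm, hqu, mul_zero]
    have h2 := hKloc _ (hπ.compl.mul hr) x hxm a m0 h1
    rw [hKx, mul_zero, mul_assoc] at h2
    have h3 := fmul_le_left hπ.compl_nonneg hra
    rw [mul_neg, mul_add, ← h2, add_zero, neg_zero] at h3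
    exact le_antisymm h3 (fmul_nonneg hπ.compl_nonneg hr10)
  have hq2 : (1 - π) * ((1 - r) * K (a + h)) = 0 := by
    have h1 : (1 - π) * (1 - r) * x = (1 - π) * (1 - r) * (a + h + h) := by
      rw [eq_comm, ← sub_eq_zero, ← mul_sub, mul_assoc,
        ← hr.compl_mul_mix (x - a) (a + h + h - x), ← hu, hr.compl.left_comm, hqu, mul_zero]
    have h2 := hKloc _ (hπ.compl.mul hr.compl) x hxm _ m2 h1
    rw [hKx, mul_zero, mul_assoc] at h2
    have h3 := fmul_le_left hπ.compl_nonneg hrb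
    rw [mul_neg, mul_add, ← h2, add_zero, neg_zero] at h3
    exact le_antisymm h3 (fmul_nonneg hπ.compl_nonneg hr11)
  have hq : (1 - π) * K (a + h) = 0 := by
    rw [← add_zero (0 : E)]
    nth_rewrite 1 [← hq1]
    rw [← hq2, ← mul_add, ← add_mul]
    simp
  -- Where `x` touches an end, it is replaced by the midpoint, which is a zero there. The distance
  -- of `y` to the chosen end becomes a weak order unit and also bounds the distance to the other
  -- end from below.
  set y := π * x + (1 - π) * (a + h) with hy
  have hKy : K y = 0 := by
    rw [hy, hKloc.map_mix hπ hxm m1, hKx, hq, mul_zero, add_zero]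
  have hv : r * (y - a) + (1 - r) * (a + h + h - y) = π * u + (1 - π) * h := by
    have h1 : r * y = π * (r * x) + (1 - π) * (r * (a + h)) := by
      rw [hy, mul_add, hπ.left_comm, hπ.compl.left_comm]
    have h2 : r * (y - a) + (1 - r) * (a + h + h - y) = r * y + r * y - r * a
        + (1 - r) * (a + h + h) - y := by noncomm_ring
    rw [h2, h1, hu, hy]
    noncomm_ring
  have hvu : IsWeakOrderUnit (r * (y - a) + (1 - r) * (a + h + h - y)) :=
    hv ▸ IsWeakOrderUnit.mix hπ hu0 hπu hπz hh
  have hy1 : r * y ≤ r * (a + h) := by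
    have h1 : r * y = π * (r * x) + (1 - π) * (r * (a + h)) := by
      rw [hy, mul_add, hπ.left_comm, hπ.compl.left_comm]
    rw [h1]
    exact (hπ.mix_mem_Icc (l := r * x) ⟨le_rfl, hx1⟩ ⟨hx1, le_rfl⟩).2
  have hy2 : (1 - r) * (a + h) ≤ (1 - r) * y := by
    have h1 : (1 - r) * y = π * ((1 - r) * x) + (1 - π) * ((1 - r) * (a + h)) := by
      rw [hy, mul_add, hπ.left_comm, hπ.compl.left_comm]
    rw [h1]
    exact (hπ.mix_mem_Icc (u := (1 - r) * x) ⟨hx2, le_rfl⟩ ⟨le_rfl, hx2⟩).1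
  refine ⟨y, hvu.mono ?_, hvu.mono ?_, ?_⟩
  · apply hr.le_of
    · rw [hr.mul_mix]
    · rw [hr.compl_mul_mix]
      calc (1 - r) * (a + h + h - y) = (1 - r) * (a + h) - (1 - r) * y + (1 - r) * h := by
            noncomm_ring
        _ ≤ 0 + (1 - r) * h := by gcongr; exact sub_nonpos.2 hy2
        _ = (1 - r) * (a + h) - (1 - r) * a := by noncomm_ring
        _ ≤ (1 - r) * y - (1 - r) * a := by gcongr
        _ = (1 - r) * (y - a) := (mul_sub _ _ _).symm
  · apply hr.le_of
    · rw [hr.mul_mix]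
      calc r * (y - a) = r * y - r * (a + h) + r * h := by noncomm_ring
        _ ≤ 0 + r * h := by gcongr; exact sub_nonpos.2 hy1
        _ = r * (a + h + h) - r * (a + h) := by noncomm_ring
        _ ≤ r * (a + h + h) - r * y := by gcongr
        _ = r * (a + h + h - y) := (mul_sub _ _ _).symm
    · rw [hr.compl_mul_mix]
  · exact hKk y hKy

end MeanValue

end OrderCalculus

theorem mainTheorem7 {E : Type u} [Ring E] [ConditionallyCompleteLattice E]
    [IsOrderedAddMonoid E] [Algebra ℝ E] [IsOrderedModule ℝ E] [IsFAlgebra E]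
    (a b : E) (hab : OrderCalculus.WLt a b) (f f' : E → E)
    (hf : OrderCalculus.OrderContinuous f (Set.Icc a b))
    (hf' : ∀ c ∈ OrderCalculus.openInterval a b,
      OrderCalculus.HasSuperOrderDerivAt f (Set.Icc a b) c (f' c)) :
    ∃ x₀ ∈ OrderCalculus.openInterval a b, (b - a) * f' x₀ = f b - f a := by
  open OrderCalculus in
  have hcont := hf.geomContOn
  have hloc := localOn_of_hasSuperOrderDerivAt hab hcont hf'
  set h : E := (1 / 3 : ℝ) • (b - a) with hh
  set F : E := (1 / 3 : ℝ) • (f b - f a) with hF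
  have hhu : IsWeakOrderUnit h := hab.smul (by norm_num)
  have hh0 := hhu.1
  have hb : a + h + h + h = b := by rw [hh]; module
  -- an interval of length `h`, well inside `[a, b]`, on which `f` increases by `F`
  have hD1 : ∀ x ∈ Set.Icc a (a + h + h), x ∈ Set.Icc a b := fun x hx =>
    ⟨hx.1, hx.2.trans (hb ▸ le_add_of_nonneg_right hh0)⟩
  have hD2 : ∀ x ∈ Set.Icc a (a + h + h), x + h ∈ Set.Icc a b := fun x hx =>
    ⟨hx.1.trans (le_add_of_nonneg_right hh0), hb ▸ add_le_add_left hx.2 h⟩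
  obtain ⟨s₀, has, hsb, hs⟩ := exists_interior_eq_zero hhu
    (hloc.increment (d := F) hD1 hD2) (hcont.increment (d := F) hD1 hD2) (by
      have hF3 : F + F + F = f b - f a := by rw [hF]; module
      simp only [increment, hb]
      calc f (a + h) - f a - F + (f (a + h + h) - f (a + h) - F) + (f b - f (a + h + h) - F)
          = f b - f a - (F + F + F) := by abel
        _ = 0 := by rw [hF3, sub_self])
  have hs0 : s₀ ∈ Set.Icc a (a + h + h) := ⟨sub_nonneg.1 has.1, sub_nonneg.1 hsb.1⟩
  obtain ⟨s, x, hs0', H⟩ := exists_nested (w := h) (s₀ := s₀)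
    (P := fun n s => s ∈ Set.Icc a b ∧ s + (1 / 2 : ℝ) ^ n • h ∈ Set.Icc a b ∧
      f (s + (1 / 2 : ℝ) ^ n • h) - f s = (1 / 2 : ℝ) ^ n • F) hh0
    (by simpa using ⟨hD1 _ hs0, hD2 _ hs0, sub_eq_zero.1 hs⟩) (by
      rintro n s ⟨h1, h2, h3⟩
      have hd0 : 0 ≤ (1 / 2 : ℝ) ^ (n + 1) • h := pow_half_smul_nonneg _ hh0
      rw [← pow_half_smul_succ n h, ← pow_half_smul_succ n F, two_smul, two_smul, ← add_assoc]
        at h3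
      rw [← pow_half_smul_succ n h, two_smul, ← add_assoc] at h2 ⊢
      obtain ⟨y, hy, hy'⟩ := exists_increment_half hloc hcont hd0 h1 h2 h3
      have h4 := add_le_add_left hy.2 ((1 / 2 : ℝ) ^ (n + 1) • h)
      exact ⟨y, ⟨⟨h1.1.trans hy.1, (le_add_of_nonneg_right hd0).trans (h4.trans h2.2)⟩,
        ⟨h1.1.trans (hy.1.trans (le_add_of_nonneg_right hd0)), h4.trans h2.2⟩, hy'⟩, hy.1, h4⟩)
  have hx : x ∈ openInterval a b := by
    have h0 := (H 0).2
    rw [hs0', pow_zero, one_smul] at h0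
    refine ⟨has.mono (sub_le_sub_right h0.1 a), hsb.mono ?_⟩
    rw [← hb, ← add_sub_add_right_eq_sub _ _ h]
    exact sub_le_sub_left h0.2 _
  refine ⟨x, hx, ?_⟩
  obtain ⟨Eps, hEps, hE⟩ := (hf' x hx).2 _ (downZero_pow_smul hh0)
  have key : |F - h * f' x| ≤ 0 := by
    refine nonpos_of_forall_le_mul hh0 hEps fun ε hε => ?_
    obtain ⟨_, ⟨n, rfl⟩, hn⟩ := hE ε hε
    obtain ⟨⟨h1, h2, h3⟩, h4, h5⟩ := H n
    set c : ℝ := (1 / 2) ^ n with hc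
    have hc0 : 0 < c := by positivity
    have hl : |s n - x| = x - s n := by
      rw [abs_sub_comm, abs_of_nonneg (sub_nonneg.2 h4)]
    have hr : |s n + c • h - x| = s n + c • h - x := abs_of_nonneg (sub_nonneg.2 h5)
    have hA := hn _ h1 (by rw [hl, sub_le_iff_le_add']; exact h5)
    have hB := hn _ h2 (by rw [hr, sub_le_iff_le_add']; exact add_le_add_left h4 _)
    rw [hl] at hA
    rw [hr] at hB
    -- The point `x` lies between the two ends, so their distances to `x` add up to exactly `c • h`,
    -- and the two error terms combine without loss.
    have hsum : c • |F - h * f' x| ≤ c • (h * ε) := by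
      rw [← abs_smul_of_nonneg hc0.le]
      calc |c • (F - h * f' x)|
          = |(f (s n + c • h) - f x - (s n + c • h - x) * f' x)
              + -(f (s n) - f x - (s n - x) * f' x)| := by
            rw [smul_sub, ← h3, ← smul_mul_assoc]
            congr 1
            noncomm_ring
        _ ≤ (s n + c • h - x) * ε + (x - s n) * ε := by
            refine (abs_add_le _ _).trans (add_le_add hB ?_)
            rwa [abs_neg]
        _ = c • (h * ε) := by
            rw [← add_mul, ← smul_mul_assoc]
            congr 1
            abel
    have := smul_le_smul_of_nonneg_left hsum (show 0 ≤ c⁻¹ by positivity)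
    rwa [smul_smul, smul_smul, inv_mul_cancel₀ hc0.ne', one_smul, one_smul] at this
  have h1 : h * f' x = F := (sub_eq_zero.1 (eq_zero_of_abs_nonpos key)).symm
  rw [hh, hF, smul_mul_assoc] at h1
  have h2 := congrArg ((3 : ℝ) • ·) h1
  simpa [smul_smul] using h2
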